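/- Convention: $F[g](t)=\hat g(t)=\int_{\mathbb R} g(x)e^{-2\pi i x t}\,dx$. Let $m\ge 1$ be an integer and let $Q:\mathbb R\to\mathbb R$ be an integrable even function with $Q(x)>0$ for all $x\ne 0$, such that $$R(x):=\frac{1}{2\pi x\,\bigl(1+(2\pi x)^{2m}\bigr)\,Q(x)}$$ is also integrable on $\mathbb R$. Put $k(t,t')=\hat Q(t-t')=\int_{\mathbb R}Q(\omega)e^{-2\pi i\omega(t-t')}\,d\omega$. Then: 1. $k$ is a real-valued, positive semidefinite, translation-invariant kernel on $\mathbb R$ with $k(t,t)\le\|Q\|_{L^1}$ for all $t$. It is universal: it is continuous and, for every compact $K\subset\mathbb R$, the linear span of $\{k(\cdot,z)|_K : z\in K\}$ is uniformly dense in $C(K)$. 2. The (real) reproducing kernel Hilbert space $\mathcal H$ of $k$ contains every compactly supported $2m$-times differentiable function $f:\mathbb R\to\mathbb R$ whose derivatives $f^{(j)}$, $0\le j\le 2m$, are bounded. For every $T>0$ and every $2m$-times differentiable $f:\mathbb R\to\mathbb R$ that vanishes outside $[0,T+1]$ and belongs to $\mathcal H$ (if $f\notin\mathcal H$ the right-hand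 side below is infinite), $$\|f\|_{\mathcal H}^2\;\le\;c(T)\,\|f'\|_{L^1}\,\bigl\|f+(-1)^m f^{(2m)}\bigr\|_{L^\infty},\qquad c(T):=\|F[R]\|_{L^1([-T-1,\,T+1])}<\infty .$$ (For odd $m$, in particular for $m=1$, the last factor is $\|f-f^{(2m)}\|_{L^\infty}$.) 3. If $R$ is non-increasing on $(0,\infty)$, then for all $T>0$ $$c(T)\;\le\;\inf_{\alpha>0}\;\left(4\pi(T+1)^2\int_0^\alpha R(x)\,x\,dx+\frac4\pi\int_\alpha^\infty\frac{R(x)}{x}\,dx\right).$$ -/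

import Mathlib

open MeasureTheory Set
open scoped FourierTransform ENNReal

noncomputable section

/-- The kernel with spectral density `Q`,
`k(s,t) = ∫ Q(ω) exp (-2πiω(s-t)) dω`. For even `Q` this integral is real. -/
def spectralKernel (Q : ℝ → ℝ) (s t : ℝ) : ℝ :=
  (𝓕 (fun ω : ℝ => (Q ω : ℂ)) (s - t)).re

/-- A real kernel `k` on a topological space is universal if it is continuous and, for every compact
set `K`, the linear span of the sections `k(·, z)`, `z ∈ K`, is uniformly dense in `C(K)`. -/
def IsUniversalKernel {X : Type*} [TopologicalSpace X] (k : X → X → ℝ) : Prop :=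
  Continuous (Function.uncurry k) ∧
    ∀ K : Set X, IsCompact K → ∀ g : X → ℝ, ContinuousOn g K → ∀ ε : ℝ, 0 < ε →
      ∃ h ∈ Submodule.span ℝ ((fun (z : X) (x : X) => k x z) '' K), ∀ x ∈ K, |h x - g x| < ε

/-- The weight `R(x) = 1 / (2πx (1 + (2πx)^(2m)) Q(x))`. -/
def spectralWeight (m : ℕ) (Q : ℝ → ℝ) (x : ℝ) : ℝ :=
  1 / (2 * Real.pi * x * (1 + (2 * Real.pi * x) ^ (2 * m)) * Q x)

/-- The constant `c(T) = ‖𝓕 R‖` in `L¹([-T-1, T+1])`. -/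
def pathConst (m : ℕ) (Q : ℝ → ℝ) (T : ℝ) : ℝ≥0∞ :=
  eLpNorm (𝓕 (fun x : ℝ => (spectralWeight m Q x : ℂ))) 1
    (volume.restrict (Icc (-T - 1) (T + 1)))

/-- `f` is `n` times differentiable (the `n`-th derivative need not be continuous). -/
def TimesDifferentiable (n : ℕ) (f : ℝ → ℝ) : Prop :=
  ∀ j < n, Differentiable ℝ (iteratedDeriv j f)

/-- `H` is a (the) reproducing kernel Hilbert space of real functions with kernel `k`. -/
def HasKernel {X : Type*} (H : Type*) [NormedAddCommGroup H] [InnerProductSpace ℝ H]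
    [CompleteSpace H] [RKHS ℝ H X ℝ] (k : X → X → ℝ) : Prop :=
  ∀ s t : X, RKHS.kernel H s t 1 = k s t

end

/-! Everything is read on the frequency side. For a finitely supported `c`, the quadratic form of
the kernel is `∫ Q |ĉ|²`, hence non-negative.

Universality: sections of the kernel are `Q`-weighted averages of characters. If `L` in the dual of
`C(K)` kills all of them, applying `L` a second time gives `∫ Q(ω) |L(e_ω)|² dω = 0`. Thus `L` kills
every trigonometric function, and these are dense by Stone–Weierstrass; Hahn–Banach concludes
(`dual_eq_zero_of_spectralKernel`).

Membership in the RKHS: if `f` is the inverse transform of `u`, Cauchy–Schwarz bounds `(∑ c i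
f(i))²` by `∫ |u|²/Q` times the quadratic form of the kernel, and Riesz representation produces `F`
with `‖F‖² ≤ ∫ |u|²/Q` (`RKHS.exists_of_fourier`). No full spectral description of the space is
needed.

Norm bound: `|f̂|²/Q` is `R` times `2πx (1 + (2πx)^(2m)) |f̂|²`, and the latter is, up to a factor
`i`, the transform of the correlation of `f'` with `f + (-1)^m f^(2m)`. The multiplication formula
moves the transform onto `R`; the correlation lives on `[-T-1, T+1]` and is bounded by the product
of the `L¹` and `L^∞` norms (`IsTestFunction.energy_le`).

Estimate of `c(T)`: `R` is odd, and for monotone `R` its sine transform is non-negative, so `|𝓕 R|`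
can be integrated exactly by Fubini; then `1 - cos y ≤ min (y²/2) 2`. -/

/-! ### Fourier transforms of real even and odd functions -/

theorem integrable_mul_cos {u : ℝ → ℝ} (hu : Integrable u) (x : ℝ) :
    Integrable (fun ω => u ω * Real.cos (2 * Real.pi * ω * x)) :=
  hu.mul_bdd (c := 1) (by fun_prop) (Filter.Eventually.of_forall fun ω => Real.abs_cos_le_one _)

theorem integrable_mul_sin {u : ℝ → ℝ} (hu : Integrable u) (x : ℝ) :
    Integrable (fun ω => u ω * Real.sin (2 * Real.pi * ω * x)) :=
  hu.mul_bdd (c := 1) (by fun_prop) (Filter.Eventually.of_forall fun ω => Real.abs_sin_le_one _)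

theorem fourier_ofReal_eq {u : ℝ → ℝ} (hu : Integrable u) (x : ℝ) :
    𝓕 (fun ω : ℝ => (u ω : ℂ)) x =
      ((∫ ω, u ω * Real.cos (2 * Real.pi * ω * x) : ℝ) : ℂ) -
        ((∫ ω, u ω * Real.sin (2 * Real.pi * ω * x) : ℝ) : ℂ) * Complex.I := by
  rw [Real.fourier_real_eq_integral_exp_smul, ← integral_complex_ofReal,
    ← integral_complex_ofReal,
    ← integral_mul_const, ← integral_sub]
  · refine integral_congr_ae (Filter.Eventually.of_forall fun ω => ?_)
    simp only [smul_eq_mul]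
    rw [Complex.exp_mul_I, ← Complex.ofReal_cos, ← Complex.ofReal_sin]
    have e : -2 * Real.pi * ω * x = -(2 * Real.pi * ω * x) := by ring
    rw [e, Real.cos_neg, Real.sin_neg]
    push_cast
    ring
  · exact (integrable_mul_cos hu x).ofReal
  · exact (integrable_mul_sin hu x).ofReal.mul_const _

theorem integral_eq_zero_of_odd_real {u : ℝ → ℝ} (hu : ∀ x, u (-x) = -u x) : ∫ x, u x = 0 := by
  have h := integral_neg_eq_self u volume
  simp only [hu, integral_neg] at h
  linarith

theorem fourier_even_eq {u : ℝ → ℝ} (hu : Integrable u) (he : ∀ x, u (-x) = u x) (x : ℝ) :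
    𝓕 (fun ω : ℝ => (u ω : ℂ)) x = ((∫ ω, u ω * Real.cos (2 * Real.pi * ω * x) : ℝ) : ℂ) := by
  rw [fourier_ofReal_eq hu, integral_eq_zero_of_odd_real (u := fun ω => u ω * Real.sin _)]
  · simp
  · intro y
    rw [he, show 2 * Real.pi * -y * x = -(2 * Real.pi * y * x) by ring, Real.sin_neg]
    ring

theorem fourier_odd_eq {u : ℝ → ℝ} (hu : Integrable u) (ho : ∀ x, u (-x) = -u x) (x : ℝ) :
    𝓕 (fun ω : ℝ => (u ω : ℂ)) x =
      -((∫ ω, u ω * Real.sin (2 * Real.pi * ω * x) : ℝ) : ℂ) * Complex.I := by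
  rw [fourier_ofReal_eq hu, integral_eq_zero_of_odd_real (u := fun ω => u ω * Real.cos _)]
  · simp
  · intro y
    rw [ho, show 2 * Real.pi * -y * x = -(2 * Real.pi * y * x) by ring, Real.cos_neg]
    ring

theorem norm_fourier_le_integral_norm (f : ℝ → ℂ) (x : ℝ) : ‖𝓕 f x‖ ≤ ∫ ω, ‖f ω‖ :=
  VectorFourier.norm_fourierIntegral_le_integral_norm _ _ _ _ _

theorem continuous_fourier_of_integrable {f : ℝ → ℂ} (hf : Integrable f) : Continuous (𝓕 f) :=
  VectorFourier.fourierIntegral_continuous Real.continuous_fourierChar continuous_inner hf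

theorem integral_mul_fourier_eq {f g : ℝ → ℂ} (hf : Integrable f) (hg : Integrable g) :
    ∫ x, 𝓕 f x * g x = ∫ x, f x * 𝓕 g x := by
  have h := VectorFourier.integral_fourierIntegral_smul_eq_flip (L := innerₗ ℝ)
    Real.continuous_fourierChar continuous_inner hf hg
  rwa [flip_innerₗ] at h

/-! ### Positive definiteness and continuity of the kernel -/

theorem spectralKernel_eq {Q : ℝ → ℝ} (hQ : Integrable Q) (he : ∀ x, Q (-x) = Q x) (s t : ℝ) :
    spectralKernel Q s t = ∫ ω, Q ω * Real.cos (2 * Real.pi * ω * (s - t)) := by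
  rw [spectralKernel, fourier_even_eq hQ he, Complex.ofReal_re]

/-- The cosine transform of the finitely supported measure `∑ c i δ_i`. -/
noncomputable def cosSum (c : ℝ →₀ ℝ) (ω : ℝ) : ℝ := c.sum fun i ci => ci * Real.cos (2 * Real.pi * ω * i)

/-- The sine transform of the finitely supported measure `∑ c i δ_i`. -/
noncomputable def sinSum (c : ℝ →₀ ℝ) (ω : ℝ) : ℝ := c.sum fun i ci => ci * Real.sin (2 * Real.pi * ω * i)

/-- The addition formula for `cos (a - b)` turns the double sum into the squared modulus of the
transform of `∑ c i δ_i`. -/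
theorem finsuppSum_mul_cos_sub (c : ℝ →₀ ℝ) (q ω : ℝ) :
    (c.sum fun i ci => c.sum fun j cj =>
      ci * (q * Real.cos (2 * Real.pi * ω * (i - j))) * cj) =
      q * (cosSum c ω ^ 2 + sinSum c ω ^ 2) := by
  simp only [cosSum, sinSum, Finsupp.sum, sq]
  rw [Finset.sum_mul_sum, Finset.sum_mul_sum]
  simp only [mul_add, Finset.mul_sum, ← Finset.sum_add_distrib]
  refine Finset.sum_congr rfl fun i _ => Finset.sum_congr rfl fun j _ => ?_
  rw [mul_sub, Real.cos_sub]
  ring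

theorem integrable_mul_cosSum_sq_add {Q : ℝ → ℝ} (hQ : Integrable Q) (c : ℝ →₀ ℝ) :
    Integrable (fun ω => Q ω * (cosSum c ω ^ 2 + sinSum c ω ^ 2)) := by
  simp only [← finsuppSum_mul_cos_sub]
  exact integrable_finsetSum _ fun i _ => integrable_finsetSum _ fun j _ =>
    ((integrable_mul_cos hQ (i - j)).const_mul (c i)).mul_const (c j)

theorem finsuppSum_spectralKernel {Q : ℝ → ℝ} (hQ : Integrable Q) (he : ∀ x, Q (-x) = Q x)
    (c : ℝ →₀ ℝ) :
    (c.sum fun i ci => c.sum fun j cj => ci * spectralKernel Q i j * cj) =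
      ∫ ω, Q ω * (cosSum c ω ^ 2 + sinSum c ω ^ 2) := by
  simp only [← finsuppSum_mul_cos_sub, spectralKernel_eq hQ he, Finsupp.sum]
  have hi : ∀ i j : ℝ,
      Integrable fun ω => c i * (Q ω * Real.cos (2 * Real.pi * ω * (i - j))) * c j := fun i j =>
    ((integrable_mul_cos hQ (i - j)).const_mul (c i)).mul_const (c j)
  rw [integral_finsetSum _ fun i _ => integrable_finsetSum _ fun j _ => hi i j]
  refine Finset.sum_congr rfl fun i _ => ?_
  rw [integral_finsetSum _ fun j _ => hi i j]
  refine Finset.sum_congr rfl fun j _ => ?_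
  rw [integral_mul_const, integral_const_mul]

theorem ae_pos_of_pos_ne_zero {Q : ℝ → ℝ} (hQ_pos : ∀ x : ℝ, x ≠ 0 → 0 < Q x) :
    ∀ᵐ x, 0 < Q x := by
  filter_upwards [Measure.ae_ne volume (0 : ℝ)] with x hx using hQ_pos x hx

theorem spectralKernel_comm {Q : ℝ → ℝ} (hQ : Integrable Q) (he : ∀ x, Q (-x) = Q x) (s t : ℝ) :
    spectralKernel Q s t = spectralKernel Q t s := by
  rw [spectralKernel_eq hQ he, spectralKernel_eq hQ he]
  congr! 3 with ω
  rw [← Real.cos_neg]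
  ring_nf

theorem posSemidef_spectralKernel {Q : ℝ → ℝ} (hQ : Integrable Q) (he : ∀ x, Q (-x) = Q x)
    (hQ_pos : ∀ x : ℝ, x ≠ 0 → 0 < Q x) : (Matrix.of (spectralKernel Q)).PosSemidef := by
  refine ⟨?_, fun c => ?_⟩
  · ext s t
    simpa using spectralKernel_comm hQ he t s
  · simp only [Matrix.of_apply, star_trivial]
    rw [finsuppSum_spectralKernel hQ he]
    refine integral_nonneg_of_ae ?_
    filter_upwards [ae_pos_of_pos_ne_zero hQ_pos] with ω hω
    have := hω.le
    positivity

theorem spectralKernel_self_le {Q : ℝ → ℝ} (hQ : Integrable Q) (he : ∀ x, Q (-x) = Q x) (t : ℝ) :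
    spectralKernel Q t t ≤ ∫ ω, |Q ω| := by
  rw [spectralKernel_eq hQ he]
  simpa using integral_mono hQ hQ.abs fun ω => le_abs_self (Q ω)

theorem continuous_spectralKernel {Q : ℝ → ℝ} (hQ : Integrable Q) :
    Continuous (Function.uncurry (spectralKernel Q)) :=
  Complex.continuous_re.comp
    ((continuous_fourier_of_integrable hQ.ofReal).comp (continuous_fst.sub continuous_snd))

/-! ### Universality -/

/-- The function `x ↦ cos (2πωx + φ)` on a compact set. -/
noncomputable def cosOn (K : Set ℝ) (ω φ : ℝ) : C(K, ℝ) :=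
  ⟨fun x => Real.cos (2 * Real.pi * ω * x + φ), by fun_prop⟩

@[simp]
theorem cosOn_apply (K : Set ℝ) (ω φ : ℝ) (x : K) :
    cosOn K ω φ x = Real.cos (2 * Real.pi * ω * x + φ) := rfl

theorem continuous_cosOn (K : Set ℝ) (φ : ℝ) : Continuous fun ω => cosOn K ω φ :=
  ContinuousMap.continuous_of_continuous_uncurry _ (by
    simp only [Function.uncurry_def, cosOn_apply]; fun_prop)

/-- The linear span of the functions `cosOn K ω φ`, as a subalgebra. -/
noncomputable def trigSubalgebra (K : Set ℝ) : Subalgebra ℝ C(K, ℝ) :=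
  (Submodule.span ℝ (range fun p : ℝ × ℝ => cosOn K p.1 p.2)).toSubalgebra
    (Submodule.subset_span ⟨(0, 0), by ext x; simp⟩) (by
      intro f g hf hg
      have h := Submodule.mul_mem_mul hf hg
      rw [Submodule.span_mul_span] at h
      refine Submodule.span_le.2 ?_ h
      rintro _ ⟨_, ⟨p, rfl⟩, _, ⟨q, rfl⟩, rfl⟩
      -- Product-to-sum formula; allowing arbitrary phases covers sines too and makes the span
      -- closed under products.
      have e : cosOn K p.1 p.2 * cosOn K q.1 q.2 =
          (2⁻¹ : ℝ) • cosOn K (p.1 - q.1) (p.2 - q.2) +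
            (2⁻¹ : ℝ) • cosOn K (p.1 + q.1) (p.2 + q.2) := by
        ext x
        simp only [ContinuousMap.mul_apply, ContinuousMap.add_apply, ContinuousMap.smul_apply,
          cosOn_apply, smul_eq_mul]
        rw [show 2 * Real.pi * (p.1 - q.1) * x + (p.2 - q.2) =
            (2 * Real.pi * p.1 * x + p.2) - (2 * Real.pi * q.1 * x + q.2) by ring,
          show 2 * Real.pi * (p.1 + q.1) * x + (p.2 + q.2) =
            (2 * Real.pi * p.1 * x + p.2) + (2 * Real.pi * q.1 * x + q.2) by ring,
          Real.cos_sub (2 * Real.pi * p.1 * x + p.2), Real.cos_add (2 * Real.pi * p.1 * x + p.2)]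
        ring
      simp only [e]
      exact Submodule.add_mem _
        (Submodule.smul_mem _ _ (Submodule.subset_span ⟨(p.1 - q.1, p.2 - q.2), rfl⟩))
        (Submodule.smul_mem _ _ (Submodule.subset_span ⟨(p.1 + q.1, p.2 + q.2), rfl⟩)))

theorem separatesPoints_trigSubalgebra (K : Set ℝ) : (trigSubalgebra K).SeparatesPoints := by
  intro x y hxy
  by_contra! h
  have hm : ∀ ω φ : ℝ, cosOn K ω φ x = cosOn K ω φ y := fun ω φ =>
    h _ ⟨cosOn K ω φ, Submodule.subset_span ⟨(ω, φ), rfl⟩, rfl⟩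
  have hxy' : (x : ℝ) - y ≠ 0 := sub_ne_zero.2 fun e => hxy (Subtype.ext e)
  -- Half a period equals `x - y`, and the phase puts `y` at angle `0`, so the values are `-1` and
  -- `1`.
  have hy := hm (1 / (2 * (x - y))) (-(2 * Real.pi * (1 / (2 * (x - y))) * y))
  have e : 2 * Real.pi * (1 / (2 * ((x : ℝ) - y))) * x +
      -(2 * Real.pi * (1 / (2 * ((x : ℝ) - y))) * y) = Real.pi := by
    field_simp
    ring
  rw [cosOn_apply, cosOn_apply, e, add_neg_cancel, Real.cos_zero, Real.cos_pi] at hy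
  norm_num at hy

theorem dual_eq_zero_of_trig {K : Set ℝ} [CompactSpace K] (L : C(K, ℝ) →L[ℝ] ℝ)
    (hL : ∀ ω φ : ℝ, L (cosOn K ω φ) = 0) : L = 0 := by
  have hd := ContinuousMap.subalgebra_topologicalClosure_eq_top_of_separatesPoints
    (trigSubalgebra K) (separatesPoints_trigSubalgebra K)
  have hle : Submodule.span ℝ (range fun p : ℝ × ℝ => cosOn K p.1 p.2) ≤
      LinearMap.ker L.toLinearMap := by
    refine Submodule.span_le.2 ?_
    rintro _ ⟨p, rfl⟩
    exact hL p.1 p.2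
  have hcl : closure (trigSubalgebra K : Set C(K, ℝ)) ⊆ {f | L f = 0} :=
    closure_minimal (fun f hf => hle hf) (isClosed_eq L.continuous continuous_const)
  ext1 f
  refine hcl ?_
  have : f ∈ (trigSubalgebra K).topologicalClosure := hd ▸ Algebra.mem_top
  exact this

theorem integrable_smul_cosOn {K : Set ℝ} [CompactSpace K] {u : ℝ → ℝ} (hu : Integrable u)
    (φ : ℝ) : Integrable fun ω => u ω • cosOn K ω φ := by
  refine hu.smul_bdd 1 (continuous_cosOn K φ).aestronglyMeasurable
    (Filter.Eventually.of_forall fun ω => ?_)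
  exact (ContinuousMap.norm_le _ zero_le_one).2 fun x => Real.abs_cos_le_one _

/-- If a functional on `C(K)` kills all sections of the kernel, it is zero: testing it twice gives
`∫ Q |L (exp (2πiω·))|² dω = 0`. -/
theorem dual_eq_zero_of_spectralKernel {Q : ℝ → ℝ} (hQ : Integrable Q)
    (he : ∀ x, Q (-x) = Q x) (hQ_pos : ∀ x : ℝ, x ≠ 0 → 0 < Q x) {K : Set ℝ} [CompactSpace K]
    (L : C(K, ℝ) →L[ℝ] ℝ)
    (hL : ∀ κ : C(K, ℝ), (∃ z : K, ∀ x : K, κ x = spectralKernel Q x z) → L κ = 0) : L = 0 := by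
  -- The phase that turns cosine into sine: `c` and `s` below are the cosine and sine transforms of
  -- `L`.
  set ψ : ℝ := -(Real.pi / 2)
  have hψ : ∀ y, Real.cos (y + ψ) = Real.sin y := fun y => by
    rw [← sub_eq_add_neg, Real.cos_sub_pi_div_two]
  set c : ℝ → ℝ := fun ω => L (cosOn K ω 0)
  set s : ℝ → ℝ := fun ω => L (cosOn K ω ψ)
  have hc : Continuous c := L.continuous.comp (continuous_cosOn K 0)
  have hs : Continuous s := L.continuous.comp (continuous_cosOn K ψ)
  have hbd : ∀ φ ω, ‖L (cosOn K ω φ)‖ ≤ ‖L‖ := fun φ ω => by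
    refine (L.le_opNorm _).trans (mul_le_of_le_one_right (norm_nonneg _) ?_)
    exact (ContinuousMap.norm_le _ zero_le_one).2 fun x => Real.abs_cos_le_one _
  -- First use of `L`: the section at `z` is a Bochner integral in `C(K)`, through which `L` passes.
  have h1 : ∀ z : K, ∫ ω, (Q ω * Real.cos (2 * Real.pi * ω * z)) * c ω +
      (Q ω * Real.sin (2 * Real.pi * ω * z)) * s ω = 0 := by
    intro z
    have i1 := integrable_smul_cosOn (K := K) (integrable_mul_cos hQ z) 0
    have i2 := integrable_smul_cosOn (K := K) (integrable_mul_sin hQ z) ψ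
    have i12 : Integrable fun ω => (Q ω * Real.cos (2 * Real.pi * ω * z)) • cosOn K ω 0 +
      (Q ω * Real.sin (2 * Real.pi * ω * z)) • cosOn K ω ψ := Integrable.add (ε' := C(K, ℝ)) i1 i2
    have := hL (∫ ω, (Q ω * Real.cos (2 * Real.pi * ω * z)) • cosOn K ω 0 +
      (Q ω * Real.sin (2 * Real.pi * ω * z)) • cosOn K ω ψ) ⟨z, fun x => ?_⟩
    · rw [← L.integral_comp_comm i12] at this
      simpa using this
    · rw [ContinuousMap.integral_apply i12, spectralKernel_eq hQ he]
      refine integral_congr_ae (Filter.Eventually.of_forall fun ω => ?_)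
      simp only [ContinuousMap.add_apply, ContinuousMap.smul_apply, cosOn_apply, smul_eq_mul, hψ,
        add_zero]
      rw [mul_sub, Real.cos_sub]
      ring
  have jc : Integrable fun ω => Q ω * c ω :=
    hQ.mul_bdd (c := ‖L‖) hc.aestronglyMeasurable (Filter.Eventually.of_forall (hbd 0))
  have js : Integrable fun ω => Q ω * s ω :=
    hQ.mul_bdd (c := ‖L‖) hs.aestronglyMeasurable (Filter.Eventually.of_forall (hbd ψ))
  have ic := integrable_smul_cosOn (K := K) jc 0
  have is := integrable_smul_cosOn (K := K) js ψ
  have ics : Integrable fun ω => (Q ω * c ω) • cosOn K ω 0 + (Q ω * s ω) • cosOn K ω ψ :=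
    Integrable.add (ε' := C(K, ℝ)) ic is
  -- The same identity read as a function of `z`: an element of `C(K)` that vanishes, to which `L`
  -- is applied again.
  have h2 : (∫ ω, (Q ω * c ω) • cosOn K ω 0 + (Q ω * s ω) • cosOn K ω ψ : C(K, ℝ)) = 0 := by
    ext z
    rw [ContinuousMap.integral_apply ics]
    refine Eq.trans ?_ (h1 z)
    refine integral_congr_ae (Filter.Eventually.of_forall fun ω => ?_)
    simp only [ContinuousMap.add_apply, ContinuousMap.smul_apply, cosOn_apply, smul_eq_mul, hψ,
      add_zero]
    ring
  have h3 : ∫ ω, Q ω * c ω * c ω + Q ω * s ω * s ω = 0 := by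
    have := congrArg L h2
    rw [← L.integral_comp_comm ics] at this
    simpa using this
  have h4 : ∀ᵐ ω, 0 ≤ Q ω * c ω * c ω + Q ω * s ω * s ω := by
    filter_upwards [ae_pos_of_pos_ne_zero hQ_pos] with ω hω
    have := hω.le
    nlinarith [mul_nonneg this (sq_nonneg (c ω)), mul_nonneg this (sq_nonneg (s ω))]
  have h5 := (integral_eq_zero_iff_of_nonneg_ae h4
    ((jc.mul_bdd (c := ‖L‖) hc.aestronglyMeasurable (Filter.Eventually.of_forall (hbd 0))).add
    (js.mul_bdd (c := ‖L‖) hs.aestronglyMeasurable (Filter.Eventually.of_forall (hbd ψ))))).1 h3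
  have h6 : ∀ᵐ ω, c ω ^ 2 + s ω ^ 2 = 0 := by
    filter_upwards [ae_pos_of_pos_ne_zero hQ_pos, h5] with ω hω h
    have : Q ω * (c ω ^ 2 + s ω ^ 2) = 0 := by
      rw [← show Q ω * c ω * c ω + Q ω * s ω * s ω = Q ω * (c ω ^ 2 + s ω ^ 2) by ring]
      exact h
    exact (mul_eq_zero.1 this).resolve_left hω.ne'
  -- Continuity in `ω` upgrades almost everywhere to everywhere.
  have h7 : (fun ω => c ω ^ 2 + s ω ^ 2) = fun _ => 0 :=
    (Continuous.ae_eq_iff_eq volume (by fun_prop) continuous_const).1 h6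
  refine dual_eq_zero_of_trig L fun ω φ => ?_
  have h8 := congrFun h7 ω
  have hc0 : L (cosOn K ω 0) = 0 := pow_eq_zero_iff two_ne_zero |>.1
    (by nlinarith [sq_nonneg (c ω), sq_nonneg (s ω)] : c ω ^ 2 = 0)
  have hs0 : L (cosOn K ω ψ) = 0 := pow_eq_zero_iff two_ne_zero |>.1
    (by nlinarith [sq_nonneg (c ω), sq_nonneg (s ω)] : s ω ^ 2 = 0)
  have e : cosOn K ω φ = Real.cos φ • cosOn K ω 0 - Real.sin φ • cosOn K ω ψ := by
    ext x
    simp only [ContinuousMap.sub_apply, ContinuousMap.smul_apply, cosOn_apply, smul_eq_mul, hψ,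
      add_zero]
    rw [Real.cos_add]
    ring
  rw [e, map_sub, map_smul, map_smul, hc0, hs0]
  simp

theorem Submodule.mem_closure_of_forall_dual {E : Type*} [NormedAddCommGroup E] [NormedSpace ℝ E]
    (S : Submodule ℝ E) (g : E) (h : ∀ L : E →L[ℝ] ℝ, (∀ b ∈ S, L b = 0) → L g = 0) :
    g ∈ closure (S : Set E) := by
  by_contra hg
  obtain ⟨L, u, hgu, hu⟩ := geometric_hahn_banach_point_closed (S.convex.closure) isClosed_closure hg
  have hu0 : u < 0 := by simpa using hu 0 (subset_closure S.zero_mem)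
  have h0 : ∀ b ∈ S, L b = 0 := by
    intro b hb
    by_contra hne
    -- This multiple of `b` has `L`-value exactly `u`, against strict separation.
    have := hu ((u / L b) • b) (subset_closure (S.smul_mem _ hb))
    rw [map_smul, smul_eq_mul, div_mul_cancel₀ _ hne] at this
    exact lt_irrefl _ this
  have := h L h0
  linarith

theorem isUniversalKernel_spectralKernel {Q : ℝ → ℝ} (hQ : Integrable Q)
    (he : ∀ x, Q (-x) = Q x) (hQ_pos : ∀ x : ℝ, x ≠ 0 → 0 < Q x) :
    IsUniversalKernel (spectralKernel Q) := by
  refine ⟨continuous_spectralKernel hQ, fun K hK g hg ε hε => ?_⟩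
  have : CompactSpace K := isCompact_iff_compactSpace.1 hK
  set W := Submodule.span ℝ ((fun (z : ℝ) (x : ℝ) => spectralKernel Q x z) '' K)
  -- Restrictions to `K` of elements of the span, so that density can be tested in the Banach space
  -- `C(K)`.
  let S : Submodule ℝ C(K, ℝ) :=
    { carrier := {κ | ∃ h ∈ W, ∀ x : K, κ x = h x}
      add_mem' := by
        rintro a b ⟨h, hh, e⟩ ⟨h', hh', e'⟩
        exact ⟨h + h', W.add_mem hh hh', fun x => by simp [e, e']⟩
      zero_mem' := ⟨0, W.zero_mem, fun x => by simp⟩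
      smul_mem' := by
        rintro r a ⟨h, hh, e⟩
        exact ⟨r • h, W.smul_mem r hh, fun x => by simp [e]⟩ }
  let g' : C(K, ℝ) := ⟨K.domRestrict g, hg.domRestrict⟩
  have hmem : g' ∈ closure (S : Set C(K, ℝ)) := by
    refine S.mem_closure_of_forall_dual g' fun L hL => ?_
    rw [dual_eq_zero_of_spectralKernel hQ he hQ_pos L, zero_apply]
    rintro κ ⟨z, hz⟩
    exact hL κ ⟨_, Submodule.subset_span ⟨z, z.2, rfl⟩, hz⟩
  obtain ⟨κ, ⟨h, hh, e⟩, hκ⟩ := Metric.mem_closure_iff.1 hmem ε hε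
  refine ⟨h, hh, fun x hx => ?_⟩
  have := (ContinuousMap.dist_lt_iff hε).1 hκ ⟨x, hx⟩
  rw [e, dist_comm, Real.dist_eq] at this
  exact this

/-! ### Membership and norm bounds in the RKHS -/

open scoped InnerProductSpace in
-- The bound says that `∑ c i k(·, i) ↦ ∑ c i f(i)` is well defined with norm at most `√N` on the
-- span of the kernel functions; extend it by Hahn–Banach and represent it by Riesz.
theorem RKHS.exists_of_sum_bound {X H : Type*} [NormedAddCommGroup H] [InnerProductSpace ℝ H]
    [CompleteSpace H] [RKHS ℝ H X ℝ] {k : X → X → ℝ} (hk : HasKernel H k) {f : X → ℝ} {N : ℝ}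
    (hN : 0 ≤ N)
    (h : ∀ c : X →₀ ℝ, (c.sum fun i ci => ci * f i) ^ 2 ≤
      N * c.sum fun i ci => c.sum fun j cj => ci * k i j * cj) :
    ∃ F : H, (∀ x, F x = f x) ∧ ‖F‖ ^ 2 ≤ N := by
  set T : (X →₀ ℝ) →ₗ[ℝ] H := Finsupp.linearCombination ℝ fun x => RKHS.kerFun H x (1 : ℝ) with hT
  set φ : (X →₀ ℝ) →ₗ[ℝ] ℝ := Finsupp.linearCombination ℝ f with hφ
  have hTn : ∀ c, ‖T c‖ ^ 2 = c.sum fun i ci => c.sum fun j cj => ci * k i j * cj := by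
    intro c
    rw [← real_inner_self_eq_norm_sq, hT, Finsupp.linearCombination_apply, Finsupp.sum_inner]
    simp only [Finsupp.sum]
    refine Finset.sum_congr rfl fun i _ => ?_
    rw [inner_sum]
    refine Finset.sum_congr rfl fun j _ => ?_
    rw [inner_smul_left, inner_smul_right, RKHS.kerFun_inner, RKHS.kerFun_apply, hk]
    simp
    ring
  have hb : ∀ c, |φ c| ≤ √N * ‖T c‖ := by
    intro c
    refine abs_le_of_sq_le_sq ?_ (by positivity)
    rw [mul_pow, Real.sq_sqrt hN, hTn]
    simpa [hφ, Finsupp.linearCombination_apply] using h c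
  -- A linear section of `T`; by `hb` the kernel of `T` lies in that of `φ`, so `φ ∘ g` does not
  -- depend on the choice of section.
  obtain ⟨g, hg⟩ := T.rangeRestrict.exists_rightInverse_of_surjective T.range_rangeRestrict
  have hTg : ∀ w : T.range, T (g w) = w := fun w =>
    congrArg Subtype.val (LinearMap.congr_fun hg w)
  let ℓ : StrongDual ℝ T.range := (φ ∘ₗ g).mkContinuous √N fun w => by
    simpa [hTg] using hb (g w)
  obtain ⟨L, hL, hLn⟩ := exists_extension_norm_eq T.range ℓ
  refine ⟨(InnerProductSpace.toDual ℝ H).symm L, fun x => ?_, ?_⟩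
  · have h1 := RKHS.inner_kerFun x (1 : ℝ) ((InnerProductSpace.toDual ℝ H).symm L)
    rw [InnerProductSpace.toDual_symm_apply] at h1
    have h2 : T (Finsupp.single x 1) = RKHS.kerFun H x (1 : ℝ) := by simp [hT]
    have h3 := hL ⟨T (Finsupp.single x 1), LinearMap.mem_range_self _ _⟩
    have h4 := hb (g ⟨T (Finsupp.single x 1), LinearMap.mem_range_self _ _⟩ - Finsupp.single x 1)
    rw [map_sub, map_sub, hTg, sub_self, norm_zero, mul_zero] at h4
    have h5 := sub_eq_zero.1 (abs_nonpos_iff.1 h4)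
    simp only [ℓ, LinearMap.mkContinuous_apply, LinearMap.comp_apply] at h3
    rw [h5, h2, h1] at h3
    simpa [hφ] using h3
  · rw [LinearIsometryEquiv.norm_map, hLn]
    calc ‖ℓ‖ ^ 2 ≤ √N ^ 2 := by
          gcongr
          exact LinearMap.mkContinuous_norm_le _ (Real.sqrt_nonneg _) _
      _ = N := Real.sq_sqrt hN

theorem RKHS.exists_of_fourier {Q : ℝ → ℝ} (hQ : Integrable Q) (he : ∀ x, Q (-x) = Q x)
    (hQ_pos : ∀ x : ℝ, x ≠ 0 → 0 < Q x) {H : Type*} [NormedAddCommGroup H]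
    [InnerProductSpace ℝ H] [CompleteSpace H] [RKHS ℝ H ℝ ℝ] (hH : HasKernel H (spectralKernel Q))
    {f : ℝ → ℝ} {u : ℝ → ℂ} (hu : Integrable u) (hf : ∀ t, (f t : ℂ) = 𝓕⁻ u t)
    (hN : Integrable fun ω => ‖u ω‖ ^ 2 / Q ω) :
    ∃ F : H, (∀ t, F t = f t) ∧ ‖F‖ ^ 2 ≤ ∫ ω, ‖u ω‖ ^ 2 / Q ω := by
  have hre : Integrable fun ω => (u ω).re := hu.re
  have him : Integrable fun ω => (u ω).im := hu.im
  have hft : ∀ t, f t = ∫ ω, (u ω).re * Real.cos (2 * Real.pi * ω * t) -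
      (u ω).im * Real.sin (2 * Real.pi * ω * t) := by
    intro t
    have e1 : f t = (𝓕⁻ u t).re := by rw [← hf, Complex.ofReal_re]
    rw [e1, Real.fourierInv_eq', ← RCLike.re_eq_complex_re, ← integral_re]
    · refine integral_congr_ae (Filter.Eventually.of_forall fun ω => ?_)
      have e2 : 2 * Real.pi * inner ℝ ω t = 2 * Real.pi * ω * t := by
        rw [real_inner_comm]
        simp [mul_assoc]
      simp only [e2, smul_eq_mul, RCLike.re_eq_complex_re, Complex.mul_re,
        Complex.exp_ofReal_mul_I_re, Complex.exp_ofReal_mul_I_im]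
      ring
    · have hc : Continuous fun ω : ℝ =>
          Complex.exp (((2 * Real.pi * inner ℝ ω t : ℝ) : ℂ) * Complex.I) := by fun_prop
      refine hu.bdd_smul 1 hc.aestronglyMeasurable (Filter.Eventually.of_forall fun ω => ?_)
      rw [Complex.norm_exp_ofReal_mul_I]
  have hsum : ∀ c : ℝ →₀ ℝ,
      Integrable (fun ω => (u ω).re * cosSum c ω - (u ω).im * sinSum c ω) ∧
      (c.sum fun i ci => ci * f i) = ∫ ω, (u ω).re * cosSum c ω - (u ω).im * sinSum c ω := by
    intro c
    have hi : ∀ t, Integrable fun ω => c t * ((u ω).re * Real.cos (2 * Real.pi * ω * t) -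
        (u ω).im * Real.sin (2 * Real.pi * ω * t)) := fun t =>
      ((integrable_mul_cos hre t).sub (integrable_mul_sin him t)).const_mul _
    have e : (fun ω => (u ω).re * cosSum c ω - (u ω).im * sinSum c ω) = fun ω =>
        ∑ t ∈ c.support, c t * ((u ω).re * Real.cos (2 * Real.pi * ω * t) -
        (u ω).im * Real.sin (2 * Real.pi * ω * t)) := by
      ext ω
      simp only [cosSum, sinSum, Finsupp.sum, Finset.mul_sum, ← Finset.sum_sub_distrib]
      exact Finset.sum_congr rfl fun t _ => by ring
    rw [e]
    refine ⟨integrable_finsetSum _ fun t _ => hi t, ?_⟩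
    rw [integral_finsetSum _ fun t _ => hi t]
    simp only [Finsupp.sum, hft, integral_const_mul]
  have hae := ae_pos_of_pos_ne_zero hQ_pos
  refine RKHS.exists_of_sum_bound hH (integral_nonneg_of_ae ?_) fun c => ?_
  · filter_upwards [hae] with ω hω
    have := hω.le
    positivity
  · rw [finsuppSum_spectralKernel hQ he, (hsum c).2]
    -- Cauchy–Schwarz as a discriminant: the quadratic in `r` is `∫ |r u - Q (cosSum c - i sinSum
    -- c)|² / Q ≥ 0`.
    have hd := discrim_le_zero (a := ∫ ω, ‖u ω‖ ^ 2 / Q ω)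
      (b := -2 * ∫ ω, (u ω).re * cosSum c ω - (u ω).im * sinSum c ω)
      (c := ∫ ω, Q ω * (cosSum c ω ^ 2 + sinSum c ω ^ 2)) fun r => by
        have i1 := (hN.mul_const (r * r))
        have i2 := (((hsum c).1.const_mul (-2)).mul_const r)
        rw [← integral_mul_const, ← integral_const_mul, ← integral_mul_const,
          ← integral_add i1 i2, ← integral_add (i1.fun_add i2) (integrable_mul_cosSum_sq_add hQ c)]
        refine integral_nonneg_of_ae ?_
        filter_upwards [hae] with ω hω
        have e : ‖u ω‖ ^ 2 = (u ω).re ^ 2 + (u ω).im ^ 2 := by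
          rw [← Complex.normSq_eq_norm_sq, Complex.normSq_apply]; ring
        have : ‖u ω‖ ^ 2 / Q ω * (r * r) +
            -2 * ((u ω).re * cosSum c ω - (u ω).im * sinSum c ω) * r +
            Q ω * (cosSum c ω ^ 2 + sinSum c ω ^ 2) =
            ((r * (u ω).re - Q ω * cosSum c ω) ^ 2 + (r * (u ω).im + Q ω * sinSum c ω) ^ 2) /
              Q ω := by
          rw [e]
          field_simp
          ring
        simp only [Pi.zero_apply]
        rw [this]
        positivity
    rw [discrim] at hd
    linarith

/-! ### Test functions and the operator `pathOp` -/

theorem MeasureTheory.Integrable.complexOfReal {u : ℝ → ℝ} (hu : Integrable u) :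
    Integrable fun x => (u x : ℂ) := hu.ofReal

theorem HasCompactSupport.iteratedDeriv {f : ℝ → ℝ} (hf : HasCompactSupport f) (n : ℕ) :
    HasCompactSupport (iteratedDeriv n f) := by
  induction n with
  | zero => simpa using hf
  | succ n ih => rw [iteratedDeriv_succ]; exact ih.deriv

theorem tsupport_iteratedDeriv_subset (f : ℝ → ℝ) (n : ℕ) :
    tsupport (iteratedDeriv n f) ⊆ tsupport f := by
  induction n with
  | zero => simp
  | succ n ih =>
    rw [iteratedDeriv_succ]
    exact (closure_minimal support_deriv_subset (isClosed_tsupport _)).trans ih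

theorem TimesDifferentiable.continuous {n : ℕ} {f : ℝ → ℝ} (hf : TimesDifferentiable n f) {j : ℕ}
    (hj : j < n) : Continuous (iteratedDeriv j f) := (hf j hj).continuous

theorem measurable_iteratedDeriv_succ (f : ℝ → ℝ) (n : ℕ) :
    Measurable (iteratedDeriv (n + 1) f) := by
  rw [iteratedDeriv_succ]; exact measurable_deriv _

theorem measurable_iteratedDeriv_two_mul {m : ℕ} (hm : 1 ≤ m) (f : ℝ → ℝ) :
    Measurable (iteratedDeriv (2 * m) f) := by
  obtain ⟨n, rfl⟩ : ∃ n, m = n + 1 := ⟨m - 1, by omega⟩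
  exact measurable_iteratedDeriv_succ f (2 * n + 1)

theorem integrable_of_eLpNorm_top_of_hasCompactSupport {g : ℝ → ℝ} (hg : Measurable g)
    (hc : HasCompactSupport g) (hb : eLpNorm g ∞ volume < ∞) : Integrable g := by
  have hmem : MemLp g ∞ volume := ⟨hg.aestronglyMeasurable, hb⟩
  have hfin : IsFiniteMeasure (volume.restrict (tsupport g)) :=
    ⟨by simpa using hc.isCompact.measure_lt_top⟩
  have h1 : IntegrableOn g (tsupport g) :=
    memLp_one_iff_integrable.1 ((hmem.restrict _).mono_exponent le_top)
  exact (integrableOn_iff_integrable_of_support_subset (subset_tsupport g)).1 h1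

theorem fourier_ofReal_deriv {u : ℝ → ℝ} (hu : Integrable u) (hd : Differentiable ℝ u)
    (hu' : Integrable (deriv u)) (x : ℝ) :
    𝓕 (fun t : ℝ => ((deriv u t : ℝ) : ℂ)) x =
      (2 * Real.pi * Complex.I * x) * 𝓕 (fun t : ℝ => (u t : ℂ)) x := by
  have e : deriv (fun t : ℝ => (u t : ℂ)) = fun t => ((deriv u t : ℝ) : ℂ) :=
    funext fun t => (hd t).hasDerivAt.ofReal_comp.deriv
  have h := Real.fourier_deriv (f := fun t : ℝ => (u t : ℂ)) hu.complexOfReal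
    (fun t => (hd t).hasDerivAt.ofReal_comp.differentiableAt) (by rw [e]; exact hu'.complexOfReal)
  rw [e] at h
  simp only [h, smul_eq_mul]

theorem fourier_ofReal_iteratedDeriv {n : ℕ} {f : ℝ → ℝ} (hd : TimesDifferentiable n f)
    (hi : ∀ j ≤ n, Integrable (iteratedDeriv j f)) (x : ℝ) :
    ∀ j ≤ n, 𝓕 (fun t : ℝ => ((iteratedDeriv j f t : ℝ) : ℂ)) x =
      (2 * Real.pi * Complex.I * x) ^ j * 𝓕 (fun t : ℝ => (f t : ℂ)) x := by
  intro j
  induction j with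
  | zero => simp
  | succ j ih =>
    intro hj
    have h := fourier_ofReal_deriv (hi j (by omega)) (hd j (by omega))
      (by rw [← iteratedDeriv_succ]; exact hi (j + 1) hj) x
    rw [iteratedDeriv_succ, h, ih (by omega)]
    ring

theorem fourier_ofReal_neg {u : ℝ → ℝ} (hu : Integrable u) (x : ℝ) :
    𝓕 (fun t : ℝ => (u t : ℂ)) (-x) = (starRingEnd ℂ) (𝓕 (fun t : ℝ => (u t : ℂ)) x) := by
  rw [fourier_ofReal_eq hu, fourier_ofReal_eq hu]
  simp [integral_neg]

/-- The operator `f ↦ f + (-1)^m f^(2m)`, with Fourier symbol `1 + (2πω)^(2m)`. -/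
noncomputable def pathOp (m : ℕ) (f : ℝ → ℝ) (t : ℝ) : ℝ :=
  f t + (-1) ^ m * iteratedDeriv (2 * m) f t

/-- Compactly supported functions that are `2m` times differentiable, with integrable
`2m`-th derivative. -/
structure IsTestFunction (m : ℕ) (f : ℝ → ℝ) : Prop where
  hasCompactSupport : HasCompactSupport f
  timesDifferentiable : TimesDifferentiable (2 * m) f
  integrable_top : Integrable (iteratedDeriv (2 * m) f)

section PathOp

variable {m : ℕ} {f : ℝ → ℝ}

theorem hasCompactSupport_pathOp (m : ℕ) (hf : HasCompactSupport f) :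
    HasCompactSupport (pathOp m f) :=
  hf.add ((hf.iteratedDeriv (2 * m)).mul_left (f := fun _ => (-1) ^ m))

theorem tsupport_pathOp_subset (m : ℕ) (f : ℝ → ℝ) :
    Function.support (pathOp m f) ⊆ tsupport f := by
  intro t ht
  by_contra h
  refine ht ?_
  have h1 : f t = 0 := image_eq_zero_of_notMem_tsupport h
  have h2 : iteratedDeriv (2 * m) f t = 0 :=
    image_eq_zero_of_notMem_tsupport fun h' => h (tsupport_iteratedDeriv_subset f _ h')
  simp [pathOp, h1, h2]

theorem IsTestFunction.integrable_iteratedDeriv (h : IsTestFunction m f) {j : ℕ}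
    (hj : j ≤ 2 * m) : Integrable (iteratedDeriv j f) := by
  rcases hj.lt_or_eq with hj | rfl
  · exact (h.timesDifferentiable.continuous hj).integrable_of_hasCompactSupport
      (h.hasCompactSupport.iteratedDeriv j)
  · exact h.integrable_top

theorem IsTestFunction.integrable (h : IsTestFunction m f) : Integrable f := by
  simpa using h.integrable_iteratedDeriv (Nat.zero_le _)

theorem IsTestFunction.integrable_pathOp (h : IsTestFunction m f) : Integrable (pathOp m f) :=
  h.integrable.add (h.integrable_top.const_mul _)

/-- Solving `pathOp` for the top derivative shows that a finite sup norm of `pathOp m f` already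
makes `f^(2m)` integrable. -/
theorem TimesDifferentiable.isTestFunction (hm : 1 ≤ m) (hd : TimesDifferentiable (2 * m) f)
    (hc : HasCompactSupport f) (hb : eLpNorm (pathOp m f) ∞ volume < ∞) : IsTestFunction m f := by
  refine ⟨hc, hd, ?_⟩
  have hcont : Continuous f := by simpa using hd.continuous (j := 0) (by omega)
  have hg : Measurable (pathOp m f) :=
    hcont.measurable.add ((measurable_iteratedDeriv_two_mul hm f).const_mul _)
  have hi := integrable_of_eLpNorm_top_of_hasCompactSupport hg (hasCompactSupport_pathOp m hc) hb
  have e : iteratedDeriv (2 * m) f = fun t => (-1) ^ m * (pathOp m f t - f t) := by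
    ext t
    rw [pathOp, add_sub_cancel_left, ← mul_assoc, ← mul_pow]
    simp
  rw [e]
  exact (hi.sub (hcont.integrable_of_hasCompactSupport hc)).const_mul _

/-- The sign `(-1)^m` cancels `i^(2m)`, which leaves a positive symbol. -/
theorem IsTestFunction.fourier_pathOp (h : IsTestFunction m f) (x : ℝ) :
    𝓕 (fun t : ℝ => (pathOp m f t : ℂ)) x =
      ((1 + (2 * Real.pi * x) ^ (2 * m) : ℝ) : ℂ) * 𝓕 (fun t : ℝ => (f t : ℂ)) x := by
  have h2 := fourier_ofReal_iteratedDeriv h.timesDifferentiable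
    (fun j hj => h.integrable_iteratedDeriv hj) x (2 * m) le_rfl
  have hI : (-1 : ℂ) ^ m * (2 * Real.pi * Complex.I * x) ^ (2 * m) =
      (2 * Real.pi * x) ^ (2 * m) := by
    rw [pow_mul, pow_mul, ← mul_pow]
    congr 1
    linear_combination (-(2 * Real.pi * x) ^ 2 : ℂ) * Complex.I_sq
  have e : 𝓕 (fun t : ℝ => (pathOp m f t : ℂ)) x = 𝓕 (fun t : ℝ => (f t : ℂ)) x +
      (-1) ^ m * 𝓕 (fun t : ℝ => ((iteratedDeriv (2 * m) f t : ℝ) : ℂ)) x := by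
    simp only [Real.fourier_eq, pathOp]
    rw [← integral_const_mul, ← integral_add]
    · refine integral_congr_ae (Filter.Eventually.of_forall fun t => ?_)
      simp only [Circle.smul_def, smul_eq_mul]
      push_cast
      ring
    · exact (Real.fourierIntegral_convergent_iff (V := ℝ) x).2 h.integrable.complexOfReal
    · exact ((Real.fourierIntegral_convergent_iff (V := ℝ) x).2 h.integrable_top.complexOfReal).const_mul _
  rw [e, h2, ← mul_assoc, hI]
  push_cast
  ring

theorem one_add_sq_le_two_mul_one_add_pow {m : ℕ} (hm : 1 ≤ m) (y : ℝ) :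
    1 + y ^ 2 ≤ 2 * (1 + y ^ (2 * m)) := by
  rw [pow_mul]
  rcases le_total (y ^ 2) 1 with h | h
  · have : 0 ≤ (y ^ 2) ^ m := by positivity
    linarith
  · have := le_self_pow₀ h (by omega : m ≠ 0)
    nlinarith

/-- The transform of `pathOp m f` is bounded, and its symbol grows at least quadratically since `m ≥
1`; hence `f̂` decays like `1/(1 + x²)`. -/
theorem IsTestFunction.integrable_fourier (hm : 1 ≤ m) (h : IsTestFunction m f) :
    Integrable (𝓕 (fun t : ℝ => (f t : ℂ))) := by
  set G := ∫ t, ‖(pathOp m f t : ℂ)‖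
  refine ((integrable_inv_one_add_sq).const_mul (2 * G)).mono'
    (continuous_fourier_of_integrable h.integrable.complexOfReal).aestronglyMeasurable
    (Filter.Eventually.of_forall fun x => ?_)
  have h1 := norm_fourier_le_integral_norm (fun t : ℝ => (pathOp m f t : ℂ)) x
  have hp : 0 ≤ (2 * Real.pi * x) ^ (2 * m) := by rw [pow_mul]; positivity
  rw [h.fourier_pathOp, norm_mul, Complex.norm_real, Real.norm_of_nonneg (by positivity)] at h1
  have h2 := one_add_sq_le_two_mul_one_add_pow hm (2 * Real.pi * x)
  have h3 : x ^ 2 ≤ (2 * Real.pi * x) ^ 2 := by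
    rw [mul_pow]
    have : 1 ≤ (2 * Real.pi) ^ 2 := by nlinarith [Real.pi_gt_three]
    nlinarith [sq_nonneg x]
  rw [← div_eq_mul_inv, le_div_iff₀ (by positivity)]
  nlinarith [norm_nonneg (𝓕 (fun t : ℝ => (f t : ℂ)) x)]

theorem IsTestFunction.fourierInv_fourier (hm : 1 ≤ m) (h : IsTestFunction m f) (t : ℝ) :
    (f t : ℂ) = 𝓕⁻ (𝓕 (fun t : ℝ => (f t : ℂ))) t := by
  have hcont : Continuous f := by simpa using h.timesDifferentiable.continuous (j := 0) (by omega)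
  rw [Continuous.fourierInv_fourier_eq (f := fun t : ℝ => (f t : ℂ)) (by fun_prop) h.integrable.complexOfReal
    (h.integrable_fourier hm)]

/-! ### The energy as a pairing of `𝓕 R` with a correlation -/

/-- The convolution of `f'` with the reflection of `f + (-1)^m f^(2m)`. -/
noncomputable def pathConv (m : ℕ) (f : ℝ → ℝ) : ℝ → ℂ :=
  convolution (fun t : ℝ => ((deriv f t : ℝ) : ℂ)) (fun t : ℝ => (pathOp m f (-t) : ℂ))
    (ContinuousLinearMap.mul ℂ ℂ) volume

theorem IsTestFunction.integrable_deriv (hm : 1 ≤ m) (h : IsTestFunction m f) :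
    Integrable (deriv f) := by
  simpa using h.integrable_iteratedDeriv (j := 1) (by omega)

theorem IsTestFunction.integrable_pathConv (hm : 1 ≤ m) (h : IsTestFunction m f) :
    Integrable (pathConv m f) :=
  Integrable.integrable_convolution _ ((h.integrable_deriv hm).complexOfReal)
    (h.integrable_pathOp.comp_neg.complexOfReal)

/-- Differentiation contributes `2πix f̂` and reflection of a real function conjugates its
transform, so the phases of `f̂` cancel. -/
theorem IsTestFunction.fourier_pathConv (hm : 1 ≤ m) (h : IsTestFunction m f) (x : ℝ) :
    𝓕 (pathConv m f) x = Complex.I *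
      ((2 * Real.pi * x * (1 + (2 * Real.pi * x) ^ (2 * m)) *
        ‖𝓕 (fun t : ℝ => (f t : ℂ)) x‖ ^ 2 : ℝ) : ℂ) := by
  have hd : Differentiable ℝ f := by simpa using h.timesDifferentiable 0 (by omega)
  have e : 𝓕 (fun t : ℝ => (pathOp m f (-t) : ℂ)) x =
      𝓕 (fun t : ℝ => (pathOp m f t : ℂ)) (-x) := by
    rw [← Real.fourierInv_eq_fourier_neg, Real.fourierInv_eq_fourier_comp_neg]
  rw [pathConv, Real.fourier_mul_convolution_eq (h.integrable_deriv hm).complexOfReal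
    h.integrable_pathOp.comp_neg.complexOfReal, e, fourier_ofReal_neg h.integrable_pathOp,
    h.fourier_pathOp, fourier_ofReal_deriv h.integrable hd (h.integrable_deriv hm), map_mul,
    Complex.conj_ofReal]
  have := Complex.mul_conj' (𝓕 (fun t : ℝ => (f t : ℂ)) x)
  push_cast
  linear_combination (2 * Real.pi * Complex.I * x * (1 + (2 * Real.pi * x) ^ (2 * m)) : ℂ) * this

theorem enorm_pathConv_le (m : ℕ) (f : ℝ → ℝ) (u : ℝ) :
    ‖pathConv m f u‖ₑ ≤ eLpNorm (deriv f) 1 volume * eLpNorm (pathOp m f) ∞ volume := by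
  have h1 : ∀ᵐ s, ‖pathOp m f (s - u)‖ₑ ≤ eLpNorm (pathOp m f) ∞ volume := by
    rw [eLpNorm_exponent_top]
    exact (measurePreserving_sub_right volume u).quasiMeasurePreserving.ae
      (ae_le_eLpNormEssSup (f := pathOp m f))
  rw [pathConv, convolution, eLpNorm_one_eq_lintegral_enorm,
    ← lintegral_mul_const _ (measurable_deriv f).enorm]
  refine (enorm_integral_le_lintegral_enorm _).trans (lintegral_mono_ae ?_)
  filter_upwards [h1] with s hs
  rw [ContinuousLinearMap.mul_apply', enorm_mul, neg_sub]
  have e : ∀ r : ℝ, ‖(r : ℂ)‖ₑ = ‖r‖ₑ := fun r => by simp [enorm_eq_nnnorm]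
  rw [e, e]
  gcongr

theorem pathConv_eq_zero {a : ℝ} (hs : Function.support f ⊆ Icc 0 a) {u : ℝ}
    (hu : u ∉ Icc (-a) a) : pathConv m f u = 0 := by
  have ht : tsupport f ⊆ Icc 0 a := closure_minimal hs isClosed_Icc
  rw [pathConv, convolution]
  refine integral_eq_zero_of_ae (Filter.Eventually.of_forall fun s => ?_)
  simp only [ContinuousLinearMap.mul_apply', neg_sub, Pi.zero_apply]
  by_cases h1 : s ∈ Icc 0 a
  · have h2 : s - u ∉ Icc 0 a := by
      intro h2
      refine hu ⟨?_, ?_⟩ <;> linarith [h1.1, h1.2, h2.1, h2.2]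
    rw [Function.notMem_support.1 fun h3 => h2 (ht (tsupport_pathOp_subset m f h3))]
    simp
  · rw [Function.notMem_support.1 fun h3 => h1 (ht (support_deriv_subset h3))]
    simp

theorem spectralWeight_mul_fourier_pathConv {Q : ℝ → ℝ} (hQ_pos : ∀ x : ℝ, x ≠ 0 → 0 < Q x)
    (hm : 1 ≤ m) (h : IsTestFunction m f) {x : ℝ} (hx : x ≠ 0) :
    ((‖𝓕 (fun t : ℝ => (f t : ℂ)) x‖ ^ 2 / Q x : ℝ) : ℂ) =
      -Complex.I * ((spectralWeight m Q x : ℂ) * 𝓕 (pathConv m f) x) := by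
  have hp : 0 ≤ (2 * Real.pi * x) ^ (2 * m) := by rw [pow_mul]; positivity
  have h1 : 1 + (2 * Real.pi * x) ^ (2 * m) ≠ 0 := by positivity
  have h2 := (hQ_pos x hx).ne'
  have e : ‖𝓕 (fun t : ℝ => (f t : ℂ)) x‖ ^ 2 / Q x = spectralWeight m Q x *
      (2 * Real.pi * x * (1 + (2 * Real.pi * x) ^ (2 * m)) *
        ‖𝓕 (fun t : ℝ => (f t : ℂ)) x‖ ^ 2) := by
    rw [spectralWeight]
    have := Real.pi_ne_zero
    field_simp
  rw [e, h.fourier_pathConv hm, Complex.ofReal_mul (spectralWeight m Q x)]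
  linear_combination ((spectralWeight m Q x : ℂ) * ((2 * Real.pi * x *
    (1 + (2 * Real.pi * x) ^ (2 * m)) * ‖𝓕 (fun t : ℝ => (f t : ℂ)) x‖ ^ 2 : ℝ) : ℂ)) *
    Complex.I_sq

theorem IsTestFunction.integrable_energy {Q : ℝ → ℝ} (hQ_pos : ∀ x : ℝ, x ≠ 0 → 0 < Q x)
    (hR : Integrable (spectralWeight m Q)) (hm : 1 ≤ m) (h : IsTestFunction m f) :
    Integrable (fun x => ‖𝓕 (fun t : ℝ => (f t : ℂ)) x‖ ^ 2 / Q x) ∧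
      ((∫ x, ‖𝓕 (fun t : ℝ => (f t : ℂ)) x‖ ^ 2 / Q x : ℝ) : ℂ) = -Complex.I *
        ∫ u, 𝓕 (fun x : ℝ => (spectralWeight m Q x : ℂ)) u * pathConv m f u := by
  have hc := h.integrable_pathConv hm
  -- The origin is excluded: there `spectralWeight` takes the default value `1 / 0 = 0`.
  have hae : (fun x => -Complex.I * ((spectralWeight m Q x : ℂ) * 𝓕 (pathConv m f) x)) =ᵐ[volume]
      fun x => ((‖𝓕 (fun t : ℝ => (f t : ℂ)) x‖ ^ 2 / Q x : ℝ) : ℂ) := by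
    filter_upwards [Measure.ae_ne volume (0 : ℝ)] with x hx
    exact (spectralWeight_mul_fourier_pathConv hQ_pos hm h hx).symm
  constructor
  · have hi : Integrable fun x =>
        -Complex.I * ((spectralWeight m Q x : ℂ) * 𝓕 (pathConv m f) x) :=
      (hR.complexOfReal.mul_bdd (continuous_fourier_of_integrable hc).aestronglyMeasurable
        (Filter.Eventually.of_forall (norm_fourier_le_integral_norm _))).const_mul _
    exact ((hi.congr hae).re).congr (Filter.Eventually.of_forall fun x => Complex.ofReal_re _)
  · rw [integral_mul_fourier_eq (hR.complexOfReal) hc, ← integral_const_mul, integral_congr_ae hae,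
      integral_complex_ofReal]

theorem IsTestFunction.energy_le {Q : ℝ → ℝ} (hQ_pos : ∀ x : ℝ, x ≠ 0 → 0 < Q x)
    (hR : Integrable (spectralWeight m Q)) (hm : 1 ≤ m) (h : IsTestFunction m f) {T : ℝ}
    (hs : Function.support f ⊆ Icc 0 (T + 1)) :
    ENNReal.ofReal (∫ x, ‖𝓕 (fun t : ℝ => (f t : ℂ)) x‖ ^ 2 / Q x) ≤
      pathConst m Q T * eLpNorm (deriv f) 1 volume * eLpNorm (pathOp m f) ∞ volume := by
  set A := eLpNorm (deriv f) 1 volume * eLpNorm (pathOp m f) ∞ volume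
  set Φ := 𝓕 (fun x : ℝ => (spectralWeight m Q x : ℂ))
  have hΦ : Continuous Φ := continuous_fourier_of_integrable hR.complexOfReal
  calc ENNReal.ofReal (∫ x, ‖𝓕 (fun t : ℝ => (f t : ℂ)) x‖ ^ 2 / Q x)
      ≤ ‖((∫ x, ‖𝓕 (fun t : ℝ => (f t : ℂ)) x‖ ^ 2 / Q x : ℝ) : ℂ)‖ₑ := by
        rw [← ofReal_norm, Complex.norm_real]
        exact ENNReal.ofReal_le_ofReal (Real.le_norm_self _)
    _ = ‖∫ u, Φ u * pathConv m f u‖ₑ := by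
        rw [(h.integrable_energy hQ_pos hR hm).2, enorm_mul]
        simp [enorm_eq_nnnorm, Φ]
    _ ≤ ∫⁻ u, ‖Φ u * pathConv m f u‖ₑ := enorm_integral_le_lintegral_enorm _
    _ ≤ ∫⁻ u, (Icc (-T - 1) (T + 1)).indicator (fun u => ‖Φ u‖ₑ * A) u := by
        refine lintegral_mono fun u => ?_
        by_cases hu : u ∈ Icc (-T - 1) (T + 1)
        · rw [indicator_of_mem hu, enorm_mul]
          gcongr
          exact enorm_pathConv_le m f u
        · rw [pathConv_eq_zero hs (u := u) (by rwa [neg_add'])]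
          simp
    _ = pathConst m Q T * A := by
        rw [lintegral_indicator measurableSet_Icc, lintegral_mul_const _ hΦ.enorm.measurable,
          pathConst, eLpNorm_one_eq_lintegral_enorm]
    _ = _ := (mul_assoc _ _ _).symm

end PathOp

/-! ### The constant `c(T)` -/

theorem spectralWeight_neg (m : ℕ) {Q : ℝ → ℝ} (he : ∀ x, Q (-x) = Q x) (x : ℝ) :
    spectralWeight m Q (-x) = -spectralWeight m Q x := by
  have h : (2 * Real.pi * -x) ^ (2 * m) = (2 * Real.pi * x) ^ (2 * m) := by
    rw [mul_neg, (even_two_mul m).neg_pow]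
  rw [spectralWeight, spectralWeight, h, he, ← one_div_neg_eq_neg_one_div]
  ring_nf

theorem spectralWeight_nonneg (m : ℕ) {Q : ℝ → ℝ} (hQ_pos : ∀ x : ℝ, x ≠ 0 → 0 < Q x) {x : ℝ}
    (hx : 0 < x) : 0 ≤ spectralWeight m Q x := by
  have := hQ_pos x hx.ne'
  rw [spectralWeight]
  positivity

theorem pathConst_lt_top (m : ℕ) {Q : ℝ → ℝ} (hR : Integrable (spectralWeight m Q)) (T : ℝ) :
    pathConst m Q T < ∞ := by
  have hc := continuous_fourier_of_integrable hR.complexOfReal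
  have : Integrable (𝓕 (fun x : ℝ => (spectralWeight m Q x : ℂ)))
      (volume.restrict (Icc (-T - 1) (T + 1))) := hc.continuousOn.integrableOn_Icc
  exact (memLp_one_iff_integrable.2 this).2

/-- The sine transform of an integrable non-increasing function is non-negative. -/
theorem integral_Ioi_mul_sin_nonneg {R : ℝ → ℝ} (hR : Integrable R) (ha : AntitoneOn R (Ioi 0))
    {t : ℝ} (ht : 0 < t) : 0 ≤ ∫ x in Ioi 0, R x * Real.sin (2 * Real.pi * x * t) := by
  have hpi := Real.pi_pos
  -- Half a period of the sine.
  set q : ℝ := 1 / (2 * t) with hq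
  have hq0 : 0 < q := by positivity
  have hqt : 2 * q * t = 1 := by rw [hq]; field_simp
  have hi : ∀ a b, IntervalIntegrable (fun x => R x * Real.sin (2 * Real.pi * x * t)) volume a b :=
    fun a b => (integrable_mul_sin hR t).intervalIntegrable
  have hi' : ∀ a b, IntervalIntegrable
      (fun x => R (x + q) * Real.sin (2 * Real.pi * x * t)) volume a b :=
    fun a b => (integrable_mul_sin (hR.comp_add_right q) t).intervalIntegrable
  -- Over one period, shifting the second half back by `q` flips the sine and leaves `(R x - R (x +
  -- q)) sin ≥ 0`.
  have hper : ∀ n : ℕ, 0 ≤ ∫ x in (2 * q * n)..(2 * q * n + q + q),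
      R x * Real.sin (2 * Real.pi * x * t) := by
    intro n
    rw [← intervalIntegral.integral_add_adjacent_intervals (hi _ (2 * q * n + q)) (hi _ _),
      ← intervalIntegral.integral_comp_add_right (a := 2 * q * n) (b := 2 * q * n + q)
        (fun x => R x * Real.sin (2 * Real.pi * x * t)) q]
    have e : ∀ x, R (x + q) * Real.sin (2 * Real.pi * (x + q) * t) =
        -(R (x + q) * Real.sin (2 * Real.pi * x * t)) := by
      intro x
      rw [show 2 * Real.pi * (x + q) * t = 2 * Real.pi * x * t + Real.pi by
        linear_combination Real.pi * hqt, Real.sin_add_pi]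
      ring
    simp only [e]
    rw [intervalIntegral.integral_neg, ← sub_eq_add_neg,
      ← intervalIntegral.integral_sub (hi _ _) (hi' _ _)]
    rw [intervalIntegral.integral_of_le (by linarith)]
    refine setIntegral_nonneg measurableSet_Ioc fun x hx => ?_
    have hn : 0 ≤ 2 * q * n := by positivity
    have hx0 : 0 < x := lt_of_le_of_lt hn hx.1
    have h1 : R (x + q) ≤ R x :=
      ha hx0 (by simp only [mem_Ioi]; linarith) (by linarith)
    have h2 : 0 ≤ Real.sin (2 * Real.pi * x * t) := by
      rw [← Real.sin_sub_nat_mul_two_pi _ n]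
      have e3 : 2 * Real.pi * x * t - n * (2 * Real.pi) =
          2 * Real.pi * t * (x - 2 * q * n) := by
        linear_combination (2 * Real.pi * n) * hqt
      have e4 : 2 * Real.pi * t * q = Real.pi := by linear_combination Real.pi * hqt
      have h5 : 0 ≤ 2 * Real.pi * t := by positivity
      rw [e3]
      refine Real.sin_nonneg_of_nonneg_of_le_pi
        (mul_nonneg h5 (by linarith [hx.1])) ?_
      exact (mul_le_mul_of_nonneg_left (by linarith [hx.2]) h5).trans_eq e4
    rw [← sub_mul]
    exact mul_nonneg (sub_nonneg.2 h1) h2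
  have hsum : ∀ n : ℕ, 0 ≤ ∫ x in (0 : ℝ)..(2 * q * n), R x * Real.sin (2 * Real.pi * x * t) := by
    intro n
    induction n with
    | zero => simp
    | succ n ih =>
      rw [show 2 * q * ((n + 1 : ℕ) : ℝ) = 2 * q * n + q + q by push_cast; ring,
        ← intervalIntegral.integral_add_adjacent_intervals (hi 0 (2 * q * n)) (hi _ _)]
      exact add_nonneg ih (hper n)
  have hlim : Filter.Tendsto (fun n : ℕ => 2 * q * (n : ℝ)) Filter.atTop Filter.atTop :=
    tendsto_natCast_atTop_atTop.const_mul_atTop (by positivity)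
  exact ge_of_tendsto' (intervalIntegral_tendsto_integral_Ioi 0
    (integrable_mul_sin hR t).integrableOn hlim) hsum

theorem norm_fourier_odd_eq {R : ℝ → ℝ} (hR : Integrable R) (ho : ∀ x, R (-x) = -R x)
    (ha : AntitoneOn R (Ioi 0)) (t : ℝ) :
    ‖𝓕 (fun x : ℝ => (R x : ℂ)) t‖ =
      2 * ∫ x in Ioi 0, R x * Real.sin (2 * Real.pi * x * |t|) := by
  have h0 : 0 ≤ ∫ x in Ioi 0, R x * Real.sin (2 * Real.pi * x * |t|) := by
    rcases (abs_nonneg t).eq_or_lt with h | h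
    · simp [← h]
    · exact integral_Ioi_mul_sin_nonneg hR ha h
  have habs : ∀ y : ℝ, (∫ x, R x * Real.sin (2 * Real.pi * x * y)) =
      2 * ∫ x in Ioi 0, R x * Real.sin (2 * Real.pi * x * y) := by
    intro y
    rw [← integral_comp_abs (f := fun x => R x * Real.sin (2 * Real.pi * x * y))]
    refine integral_congr_ae (Filter.Eventually.of_forall fun x => ?_)
    rcases abs_choice x with h | h
    · simp only [h]
    · simp only [h, ho, mul_neg, neg_mul, Real.sin_neg, neg_neg]
  rw [fourier_odd_eq hR ho, norm_mul, norm_neg, Complex.norm_I, mul_one, Complex.norm_real, habs]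
  rcases abs_choice t with h | h
  · rw [h] at h0 ⊢
    rw [Real.norm_of_nonneg (by positivity)]
  · rw [h] at h0 ⊢
    simp only [mul_neg, Real.sin_neg, integral_neg] at h0 ⊢
    rw [Real.norm_of_nonpos (by linarith)]

theorem integral_sin_mul_eq {x : ℝ} (hx : x ≠ 0) (a : ℝ) :
    ∫ t in (0 : ℝ)..a, Real.sin (2 * Real.pi * x * t) =
      (1 - Real.cos (2 * Real.pi * x * a)) / (2 * Real.pi * x) := by
  have hc : 2 * Real.pi * x ≠ 0 := by have := Real.pi_ne_zero; positivity
  rw [intervalIntegral.integral_comp_mul_left (fun y => Real.sin y) hc]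
  rw [integral_sin, mul_zero, Real.cos_zero, smul_eq_mul, inv_mul_eq_div]

theorem intervalIntegral_integral_Ioi_mul_sin {R : ℝ → ℝ} (hR : Integrable R) {a : ℝ}
    (ha : 0 ≤ a) :
    ∫ t in (0 : ℝ)..a, ∫ x in Ioi 0, R x * Real.sin (2 * Real.pi * x * t) =
      ∫ x in Ioi 0, R x * ((1 - Real.cos (2 * Real.pi * x * a)) / (2 * Real.pi * x)) := by
  rw [intervalIntegral.integral_of_le ha, integral_integral_swap]
  · refine setIntegral_congr_fun measurableSet_Ioi fun x hx => ?_
    simp only [integral_const_mul]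
    rw [← intervalIntegral.integral_of_le ha, integral_sin_mul_eq (ne_of_gt hx)]
  · have h1 : Integrable (fun p : ℝ × ℝ => (1 : ℝ) * R p.2)
        ((volume.restrict (Ioc 0 a)).prod (volume.restrict (Ioi 0))) :=
      Integrable.mul_prod (f := fun _ => (1 : ℝ)) (integrable_const _) hR.integrableOn
    have hs : Continuous fun p : ℝ × ℝ => Real.sin (2 * Real.pi * p.2 * p.1) := by fun_prop
    have h2 := h1.mul_bdd (c := 1) hs.aestronglyMeasurable
      (Filter.Eventually.of_forall fun p => Real.abs_sin_le_one _)
    simpa [Function.uncurry_def] using h2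

/-- Without cancellation in the sine transform, `|𝓕 R|` is even and equals twice that transform on
`t ≥ 0`, so the order of integration can be exchanged and the sine integrated explicitly. -/
theorem pathConst_eq (m : ℕ) {Q : ℝ → ℝ} (he : ∀ x, Q (-x) = Q x)
    (hR : Integrable (spectralWeight m Q)) (ha : AntitoneOn (spectralWeight m Q) (Ioi 0)) {T : ℝ}
    (hT : 0 < T) :
    pathConst m Q T = ENNReal.ofReal (4 * ∫ x in Ioi 0, spectralWeight m Q x *
      ((1 - Real.cos (2 * Real.pi * x * (T + 1))) / (2 * Real.pi * x))) := by
  set Φ := 𝓕 (fun x : ℝ => (spectralWeight m Q x : ℂ)) with hΦ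
  have hc : Continuous Φ := continuous_fourier_of_integrable hR.complexOfReal
  have hn := norm_fourier_odd_eq hR (spectralWeight_neg m he) ha
  have hi : ∀ a b, IntervalIntegrable (fun t => ‖Φ t‖) volume a b :=
    fun a b => hc.norm.intervalIntegrable a b
  have hsymm : ∀ t, ‖Φ (-t)‖ = ‖Φ t‖ := fun t => by rw [hn, hn, abs_neg]
  have hhalf : ∫ t in (-(T + 1))..0, ‖Φ t‖ = ∫ t in (0 : ℝ)..(T + 1), ‖Φ t‖ := by
    have := intervalIntegral.integral_comp_neg (a := 0) (b := T + 1) fun t => ‖Φ t‖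
    rw [neg_zero] at this
    rw [← this]
    simp only [hsymm]
  have hpos : ∫ t in (0 : ℝ)..(T + 1), ‖Φ t‖ = 2 * ∫ t in (0 : ℝ)..(T + 1),
      ∫ x in Ioi 0, spectralWeight m Q x * Real.sin (2 * Real.pi * x * t) := by
    rw [← intervalIntegral.integral_const_mul]
    refine intervalIntegral.integral_congr fun t ht => ?_
    rw [uIcc_of_le (by linarith)] at ht
    simp only [hΦ]
    rw [hn, abs_of_nonneg ht.1]
  have htot : ∫ t in Icc (-T - 1) (T + 1), ‖Φ t‖ = 4 * ∫ x in Ioi 0, spectralWeight m Q x *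
      ((1 - Real.cos (2 * Real.pi * x * (T + 1))) / (2 * Real.pi * x)) := by
    rw [integral_Icc_eq_integral_Ioc, ← intervalIntegral.integral_of_le (by linarith),
      ← neg_add', ← intervalIntegral.integral_add_adjacent_intervals (hi _ 0) (hi _ _), hhalf,
      hpos, intervalIntegral_integral_Ioi_mul_sin hR (by linarith)]
    ring
  rw [pathConst, eLpNorm_one_eq_lintegral_enorm, ← htot,
    ofReal_integral_norm_eq_lintegral_enorm hc.continuousOn.integrableOn_Icc]

/-- Uses `1 - cos y ≤ y²/2` on `(0, α]` and `1 - cos y ≤ 2` beyond `α`. -/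
theorem pathConst_le (m : ℕ) {Q : ℝ → ℝ} (hQ_pos : ∀ x : ℝ, x ≠ 0 → 0 < Q x)
    (he : ∀ x, Q (-x) = Q x) (hR : Integrable (spectralWeight m Q))
    (ha : AntitoneOn (spectralWeight m Q) (Ioi 0)) {T : ℝ} (hT : 0 < T) {α : ℝ} (hα : 0 < α) :
    pathConst m Q T ≤ ENNReal.ofReal (4 * Real.pi * (T + 1) ^ 2) *
        (∫⁻ x in Ioc 0 α, ENNReal.ofReal (spectralWeight m Q x * x)) +
      ENNReal.ofReal (4 / Real.pi) *
        ∫⁻ x in Ioi α, ENNReal.ofReal (spectralWeight m Q x / x) := by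
  have hpi := Real.pi_pos
  have hcos : ∀ y : ℝ, 0 ≤ 1 - Real.cos y := fun y => by linarith [Real.cos_le_one y]
  have hb1 : ∀ x : ℝ, 0 < x → 4 * (spectralWeight m Q x *
      ((1 - Real.cos (2 * Real.pi * x * (T + 1))) / (2 * Real.pi * x))) ≤
      4 * Real.pi * (T + 1) ^ 2 * (spectralWeight m Q x * x) := by
    intro x hx
    have h1 := Real.one_sub_sq_div_two_le_cos (x := 2 * Real.pi * x * (T + 1))
    have h2 : (1 - Real.cos (2 * Real.pi * x * (T + 1))) / (2 * Real.pi * x) ≤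
        Real.pi * (T + 1) ^ 2 * x := by
      rw [div_le_iff₀ (by positivity)]
      nlinarith
    have := mul_le_mul_of_nonneg_left h2 (spectralWeight_nonneg m hQ_pos hx)
    linarith
  have hb2 : ∀ x : ℝ, 0 < x → 4 * (spectralWeight m Q x *
      ((1 - Real.cos (2 * Real.pi * x * (T + 1))) / (2 * Real.pi * x))) ≤
      4 / Real.pi * (spectralWeight m Q x / x) := by
    intro x hx
    have h1 := Real.neg_one_le_cos (2 * Real.pi * x * (T + 1))
    have h2 : (1 - Real.cos (2 * Real.pi * x * (T + 1))) / (2 * Real.pi * x) ≤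
        1 / (Real.pi * x) := by
      rw [div_le_div_iff₀ (by positivity) (by positivity)]
      nlinarith [mul_pos hpi hx]
    have := mul_le_mul_of_nonneg_left h2 (spectralWeight_nonneg m hQ_pos hx)
    have e : 4 / Real.pi * (spectralWeight m Q x / x) =
        4 * (spectralWeight m Q x * (1 / (Real.pi * x))) := by field_simp
    linarith
  rw [pathConst_eq m he hR ha hT, ← integral_const_mul]
  calc _ ≤ ∫⁻ x in Ioi 0, ENNReal.ofReal (4 * (spectralWeight m Q x *
        ((1 - Real.cos (2 * Real.pi * x * (T + 1))) / (2 * Real.pi * x)))) := by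
        refine (ENNReal.ofReal_le_ofReal (Real.le_norm_self _)).trans ?_
        rw [ofReal_norm]
        refine (enorm_integral_le_lintegral_enorm _).trans
          (setLIntegral_mono' measurableSet_Ioi fun x hx => ?_)
        rw [Real.enorm_of_nonneg]
        have hx0 : 0 < x := hx
        have := spectralWeight_nonneg m hQ_pos hx0
        have := hcos (2 * Real.pi * x * (T + 1))
        positivity
    _ = _ := by
        rw [← Ioc_union_Ioi_eq_Ioi hα.le,
          lintegral_union measurableSet_Ioi (Ioc_disjoint_Ioi le_rfl)]
    _ ≤ _ := by
        rw [← lintegral_const_mul' _ _ ENNReal.ofReal_ne_top,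
          ← lintegral_const_mul' _ _ ENNReal.ofReal_ne_top]
        refine add_le_add (setLIntegral_mono' measurableSet_Ioc fun x hx => ?_)
          (setLIntegral_mono' measurableSet_Ioi fun x hx => ?_)
        · rw [← ENNReal.ofReal_mul (by positivity)]
          exact ENNReal.ofReal_le_ofReal (hb1 x hx.1)
        · rw [← ENNReal.ofReal_mul (by positivity)]
          exact ENNReal.ofReal_le_ofReal (hb2 x (hα.trans hx))

/-! ### Non-vanishing of `c(T)` and conclusion -/

/-- The constant `c(T)` does not vanish: otherwise the energy of a bump function would. -/
theorem pathConst_ne_zero {m : ℕ} (hm : 1 ≤ m) {Q : ℝ → ℝ} (hQ : Integrable Q)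
    (he : ∀ x, Q (-x) = Q x) (hQ_pos : ∀ x : ℝ, x ≠ 0 → 0 < Q x)
    (hR : Integrable (spectralWeight m Q)) {H : Type*} [NormedAddCommGroup H]
    [InnerProductSpace ℝ H] [CompleteSpace H] [RKHS ℝ H ℝ ℝ] (hH : HasKernel H (spectralKernel Q))
    {T : ℝ} (hT : 0 < T) : pathConst m Q T ≠ 0 := by
  intro h0
  let b : ContDiffBump ((T + 1) / 2) :=
    -- The outer radius equals the centre, so the support is the open interval `(0, T + 1)`.
    ⟨(T + 1) / 4, (T + 1) / 2, by linarith, by linarith⟩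
  have hs : Function.support (b : ℝ → ℝ) ⊆ Icc 0 (T + 1) := by
    rw [b.support_eq, Real.ball_eq_Ioo]
    refine Ioo_subset_Icc_self.trans (Icc_subset_Icc ?_ ?_) <;> simp [b]
  have hb : ContDiff ℝ (2 * m : ℕ) (b : ℝ → ℝ) := b.contDiff
  have hd : TimesDifferentiable (2 * m) (b : ℝ → ℝ) := fun j hj =>
    hb.differentiable_iteratedDeriv j (by exact_mod_cast hj)
  have hf : IsTestFunction m (b : ℝ → ℝ) :=
    ⟨b.hasCompactSupport, hd, (hb.continuous_iteratedDeriv _ le_rfl).integrable_of_hasCompactSupport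
      (b.hasCompactSupport.iteratedDeriv _)⟩
  obtain ⟨F, hF, hFn⟩ := RKHS.exists_of_fourier hQ he hQ_pos hH (hf.integrable_fourier hm)
    (hf.fourierInv_fourier hm) (hf.integrable_energy hQ_pos hR hm).1
  have h1 := hf.energy_le hQ_pos hR hm hs
  rw [h0, zero_mul, zero_mul, nonpos_iff_eq_zero, ENNReal.ofReal_eq_zero] at h1
  have hF0 : F = 0 := norm_eq_zero.1 (pow_eq_zero_iff two_ne_zero |>.1
    (le_antisymm (hFn.trans h1) (sq_nonneg _)))
  have h2 := hF ((T + 1) / 2)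
  rw [hF0, b.one_of_mem_closedBall (Metric.mem_closedBall_self b.rIn_pos.le)] at h2
  simp at h2

theorem RKHS.exists_of_bounded_iteratedDeriv {m : ℕ} (hm : 1 ≤ m) {Q : ℝ → ℝ} (hQ : Integrable Q)
    (he : ∀ x, Q (-x) = Q x) (hQ_pos : ∀ x : ℝ, x ≠ 0 → 0 < Q x)
    (hR : Integrable (spectralWeight m Q)) {H : Type*} [NormedAddCommGroup H]
    [InnerProductSpace ℝ H] [CompleteSpace H] [RKHS ℝ H ℝ ℝ] (hH : HasKernel H (spectralKernel Q))
    {f : ℝ → ℝ} (hc : HasCompactSupport f) (hd : TimesDifferentiable (2 * m) f) {C : ℝ}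
    (hb : ∀ t, |iteratedDeriv (2 * m) f t| ≤ C) : ∃ F : H, ∀ t, F t = f t := by
  have hf : IsTestFunction m f := ⟨hc, hd, integrable_of_eLpNorm_top_of_hasCompactSupport
    (measurable_iteratedDeriv_two_mul hm f) (hc.iteratedDeriv _)
    (memLp_top_of_bound (measurable_iteratedDeriv_two_mul hm f).aestronglyMeasurable C
      (Filter.Eventually.of_forall hb)).2⟩
  obtain ⟨F, hF, -⟩ := RKHS.exists_of_fourier hQ he hQ_pos hH (hf.integrable_fourier hm)
    (hf.fourierInv_fourier hm) (hf.integrable_energy hQ_pos hR hm).1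
  exact ⟨F, hF⟩

theorem RKHS.ofReal_norm_sq_le {m : ℕ} (hm : 1 ≤ m) {Q : ℝ → ℝ} (hQ : Integrable Q)
    (he : ∀ x, Q (-x) = Q x) (hQ_pos : ∀ x : ℝ, x ≠ 0 → 0 < Q x)
    (hR : Integrable (spectralWeight m Q)) {H : Type*} [NormedAddCommGroup H]
    [InnerProductSpace ℝ H] [CompleteSpace H] [RKHS ℝ H ℝ ℝ] (hH : HasKernel H (spectralKernel Q))
    {T : ℝ} (hT : 0 < T) {f : ℝ → ℝ} (hd : TimesDifferentiable (2 * m) f)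
    (hs : Function.support f ⊆ Icc 0 (T + 1)) {F : H} (hF : ∀ t, F t = f t) :
    ENNReal.ofReal (‖F‖ ^ 2) ≤ pathConst m Q T * eLpNorm (deriv f) 1 volume *
      eLpNorm (pathOp m f) ∞ volume := by
  have hc : HasCompactSupport f := HasCompactSupport.of_support_subset_isCompact isCompact_Icc hs
  by_cases hb : eLpNorm (pathOp m f) ∞ volume < ∞
  · have hf := hd.isTestFunction hm hc hb
    obtain ⟨F', hF', hFn⟩ := RKHS.exists_of_fourier hQ he hQ_pos hH (hf.integrable_fourier hm)
      (hf.fourierInv_fourier hm) (hf.integrable_energy hQ_pos hR hm).1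
    have e : F = F' := RKHS.ext fun t => (hF t).trans (hF' t).symm
    rw [e]
    exact (ENNReal.ofReal_le_ofReal hFn).trans (hf.energy_le hQ_pos hR hm hs)
  -- The sup norm is infinite here. As `0 * ∞ = 0` in `ℝ≥0∞`, the bound is trivial only if the other
  -- two factors are non-zero.
  · have hfd : Differentiable ℝ f := by simpa using hd 0 (by omega)
    by_cases h1 : eLpNorm (deriv f) 1 volume = 0
    · have hcont : Continuous (deriv f) := by simpa using (hd 1 (by omega)).continuous
      rw [eLpNorm_eq_zero_iff hcont.aestronglyMeasurable one_ne_zero] at h1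
      have h2 : deriv f = 0 := (Continuous.ae_eq_iff_eq volume hcont continuous_const).1 h1
      have h3 : ∀ t, f t = 0 := fun t => by
        -- The point `-1` lies outside `[0, T + 1]`, so the constant is `0`.
        rw [is_const_of_deriv_eq_zero hfd (fun s => congrFun h2 s) t (-1)]
        by_contra h
        have := (hs h).1
        norm_num at this
      have e : F = 0 := RKHS.ext fun t => by rw [hF, h3, RKHS.coe_zero, Pi.zero_apply]
      simp [e]
    · rw [not_lt_top_iff.1 hb, ENNReal.mul_top
        (mul_ne_zero (pathConst_ne_zero hm hQ he hQ_pos hR hH hT) h1)]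
      exact le_top

theorem mainTheorem3 (m : ℕ) (hm : 1 ≤ m) (Q : ℝ → ℝ)
    (hQ_int : Integrable Q) (hQ_pos : ∀ x : ℝ, x ≠ 0 → 0 < Q x)
    (hQ_even : ∀ x : ℝ, Q (-x) = Q x)
    (hR_int : Integrable (spectralWeight m Q)) :
    -- the Fourier integral defining the kernel is real, and `k` is a translation-invariant
    -- universal kernel with `k(t,t) ≤ ‖Q‖` in `L¹`
    (∀ s t : ℝ, ((spectralKernel Q s t : ℝ) : ℂ) = 𝓕 (fun ω : ℝ => (Q ω : ℂ)) (s - t)) ∧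
    (Matrix.of (spectralKernel Q)).PosSemidef ∧
    (∀ s t h : ℝ, spectralKernel Q (s + h) (t + h) = spectralKernel Q s t) ∧
    IsUniversalKernel (spectralKernel Q) ∧
    (∀ t : ℝ, spectralKernel Q t t ≤ ∫ ω, |Q ω|) ∧
    -- the RKHS of `k`
    (∀ (H : Type*) [NormedAddCommGroup H] [InnerProductSpace ℝ H] [CompleteSpace H]
        [RKHS ℝ H ℝ ℝ], HasKernel H (spectralKernel Q) →
      (∀ f : ℝ → ℝ, HasCompactSupport f → TimesDifferentiable (2 * m) f →
        (∀ j ≤ 2 * m, ∃ C : ℝ, ∀ t : ℝ, |iteratedDeriv j f t| ≤ C) →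
        ∃ F : H, ∀ t : ℝ, F t = f t) ∧
      (∀ T : ℝ, 0 < T → ∀ f : ℝ → ℝ, TimesDifferentiable (2 * m) f →
        Function.support f ⊆ Icc 0 (T + 1) →
        ∀ F : H, (∀ t : ℝ, F t = f t) →
          ENNReal.ofReal (‖F‖ ^ 2) ≤ pathConst m Q T * eLpNorm (deriv f) 1 volume *
            eLpNorm (fun t => f t + (-1) ^ m * iteratedDeriv (2 * m) f t) ∞ volume)) ∧
    -- the constant `c(T)`
    (∀ T : ℝ, 0 < T → pathConst m Q T < ∞) ∧
    (AntitoneOn (spectralWeight m Q) (Ioi 0) → ∀ T : ℝ, 0 < T →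
      pathConst m Q T ≤ ⨅ (α : ℝ) (_ : 0 < α),
        (ENNReal.ofReal (4 * Real.pi * (T + 1) ^ 2) *
            (∫⁻ x in Ioc 0 α, ENNReal.ofReal (spectralWeight m Q x * x)) +
          ENNReal.ofReal (4 / Real.pi) *
            ∫⁻ x in Ioi α, ENNReal.ofReal (spectralWeight m Q x / x))) := by
  refine ⟨fun s t => ?_, posSemidef_spectralKernel hQ_int hQ_even hQ_pos, fun s t h => ?_,
    isUniversalKernel_spectralKernel hQ_int hQ_even hQ_pos,
    spectralKernel_self_le hQ_int hQ_even, ?_, fun T _ => pathConst_lt_top m hR_int T,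
    fun ha T hT => le_iInf₂ fun α hα => pathConst_le m hQ_pos hQ_even hR_int ha hT hα⟩
  · rw [spectralKernel, fourier_even_eq hQ_int hQ_even, Complex.ofReal_re]
  · rw [spectralKernel, spectralKernel, add_sub_add_right_eq_sub]
  · intro H _ _ _ _ hH
    refine ⟨fun f hc hd hb => ?_, fun T hT f hd hs F hF => ?_⟩
    · obtain ⟨C, hC⟩ := hb (2 * m) le_rfl
      exact RKHS.exists_of_bounded_iteratedDeriv hm hQ_int hQ_even hQ_pos hR_int hH hc hd hC
    · exact RKHS.ofReal_norm_sq_le hm hQ_int hQ_even hQ_pos hR_int hH hT hd hs hF
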